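/- Let $\Omega\subset\mathbb{C}$ be a simply connected domain (open, non-empty, connected) with non-empty boundary, let $\varphi$ be a conformal homeomorphism (holomorphic bijection) of $\Omega$ onto the unit disc $\mathbb{D}$, and let $h(z)=|\varphi'(z)|^2$ be the corresponding conformal weight on $\Omega$. Let $W^1_2(\Omega)$ be the space of real-valued functions $f\in L_2(\Omega)$ with weak gradient $\nabla f\in L_2(\Omega)$, with the norm $$\|f\mid W^1_2(\Omega)\|=\Big(\int_\Omega|f|^2\,d\mu\Big)^{1/2}+\Big(\int_\Omega|\nabla f|^2\,d\mu\Big)^{1/2},$$ where $\mu$ is the Lebesgue measure; let $\overset{\circ}{W}{}^1_2(\Omega)$ be the closure of $C_0^\infty(\Omega)$ (smooth real functions with compact support in $\Omega$) in $W^1_2(\Omega)$; and let $L_r(\Omega,h)$ be the space of real functions with finite norm $\big(\int_\Omega|f|^r h\,d\mu\big)^{1/r}$. Then for every $1\le r<\infty$ every $f\in\overset{\circ}{W}{}^1_2(\Omega)$ belongs to $L_r(\Omega,h)$, and the embedding operator $$j_r:\overset{\circ}{W}{}^1_2(\Omega)\hookrightarrow L_r(\Omega,h),\qquad j_r f=f,$$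 is a bounded and compact linear operator. -/

import Mathlib

open MeasureTheory Set
open scoped ContDiff ENNReal

noncomputable section

/-- `η ∈ C₀^∞(Ω)`: a smooth real-valued function whose support is a compact subset of `Ω`
(extended by zero to the whole plane). -/
structure IsTestFunction (Ω : Set ℂ) (η : ℂ → ℝ) : Prop where
  contDiff : ContDiff ℝ ∞ η
  hasCompactSupport : HasCompactSupport η
  tsupport_subset : tsupport η ⊆ Ω

lemma IsTestFunction.zero (Ω : Set ℂ) : IsTestFunction Ω (fun _ => 0) where
  contDiff := contDiff_const
  hasCompactSupport := HasCompactSupport.zero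
  tsupport_subset := by simp [tsupport, Function.support]

lemma IsTestFunction.add {Ω : Set ℂ} {η θ : ℂ → ℝ} (hη : IsTestFunction Ω η)
    (hθ : IsTestFunction Ω θ) : IsTestFunction Ω (fun z => η z + θ z) where
  contDiff := hη.contDiff.add hθ.contDiff
  hasCompactSupport := hη.hasCompactSupport.add hθ.hasCompactSupport
  tsupport_subset := (tsupport_add η θ).trans
    (union_subset hη.tsupport_subset hθ.tsupport_subset)

lemma IsTestFunction.const_mul {Ω : Set ℂ} {η : ℂ → ℝ} (c : ℝ) (hη : IsTestFunction Ω η) :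
    IsTestFunction Ω (fun z => c * η z) where
  contDiff := contDiff_const.mul hη.contDiff
  hasCompactSupport := hη.hasCompactSupport.mul_left (f := fun _ => c)
  tsupport_subset := (tsupport_mul_subset_right (f := fun _ => c)).trans hη.tsupport_subset

lemma IsTestFunction.memLp {Ω : Set ℂ} {η : ℂ → ℝ} (hη : IsTestFunction Ω η) :
    MemLp η 2 (volume.restrict Ω) :=
  (hη.contDiff.continuous.memLp_of_hasCompactSupport hη.hasCompactSupport).restrict Ω

lemma IsTestFunction.memLp_fderiv {Ω : Set ℂ} {η : ℂ → ℝ} (hη : IsTestFunction Ω η) (v : ℂ) :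
    MemLp (fun z => fderiv ℝ η z v) 2 (volume.restrict Ω) :=
  (((hη.contDiff.continuous_fderiv (by simp)).clm_apply
    continuous_const).memLp_of_hasCompactSupport
      (hη.hasCompactSupport.fderiv_apply ℝ v)).restrict Ω

lemma IsTestFunction.integrable_mul_fderiv {Ω : Set ℂ} {η : ℂ → ℝ} (hη : IsTestFunction Ω η)
    (f : Lp ℝ 2 (volume.restrict Ω)) (v : ℂ) :
    Integrable (fun z => f z * fderiv ℝ η z v) (volume.restrict Ω) :=
  (Lp.memLp f).integrable_mul (hη.memLp_fderiv v)

lemma IsTestFunction.integrable_mul_inner {Ω : Set ℂ} {η : ℂ → ℝ} (hη : IsTestFunction Ω η)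
    (g : Lp ℂ 2 (volume.restrict Ω)) (v : ℂ) :
    Integrable (fun z => η z * inner ℝ (g z) v) (volume.restrict Ω) :=
  hη.memLp.integrable_mul ((Lp.memLp g).inner_const v)

/-- `g ∈ L₂(Ω; ℝ²)` is the weak gradient of `f ∈ L₂(Ω)`. The plane `ℝ²` is identified with `ℂ`
and carries the real inner product of `ℂ`, so `g = ∂f/∂x + i ∂f/∂y`; the integration by parts
formula is required for the derivative in every direction `v`. -/
def IsWeakGradient (Ω : Set ℂ) (f : Lp ℝ 2 (volume.restrict Ω))
    (g : Lp ℂ 2 (volume.restrict Ω)) : Prop :=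
  ∀ η : ℂ → ℝ, IsTestFunction Ω η → ∀ v : ℂ,
    ∫ z in Ω, f z * fderiv ℝ η z v = -∫ z in Ω, η z * inner ℝ (g z) v

/-- The Sobolev space `W¹₂(Ω)` of real functions `f ∈ L₂(Ω)` having a weak gradient
`∇f ∈ L₂(Ω)`. A function is represented by the pair `(f, ∇f)`, and the `WithLp 1` product gives
it the norm `‖f‖_{L₂(Ω)} + ‖∇f‖_{L₂(Ω)}`. On an open set `Ω` the pair is determined
by `f`, see `W12_ext`. -/
def W12 (Ω : Set ℂ) :
    Submodule ℝ (WithLp 1 (Lp ℝ 2 (volume.restrict Ω) × Lp ℂ 2 (volume.restrict Ω))) where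
  carrier := {u | IsWeakGradient Ω u.fst u.snd}
  zero_mem' := by
    intro η _ v
    have h1 : ∫ z in Ω, (0 : Lp ℝ 2 (volume.restrict Ω)) z * fderiv ℝ η z v = 0 := by
      apply integral_eq_zero_of_ae
      filter_upwards [Lp.coeFn_zero ℝ 2 (volume.restrict Ω)] with z hz
      rw [hz, Pi.zero_apply, zero_mul]
    have h2 : ∫ z in Ω, η z * inner ℝ ((0 : Lp ℂ 2 (volume.restrict Ω)) z) v = 0 := by
      apply integral_eq_zero_of_ae
      filter_upwards [Lp.coeFn_zero ℂ 2 (volume.restrict Ω)] with z hz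
      simp only [hz, Pi.zero_apply, inner_zero_left, mul_zero]
    exact h1.trans (by rw [← neg_zero, ← h2]; rfl)
  add_mem' := by
    intro a b ha hb η hη v
    have h1 : ∫ z in Ω, (a.fst + b.fst) z * fderiv ℝ η z v
        = (∫ z in Ω, a.fst z * fderiv ℝ η z v) + ∫ z in Ω, b.fst z * fderiv ℝ η z v := by
      rw [← integral_add (hη.integrable_mul_fderiv a.fst v)
        (hη.integrable_mul_fderiv b.fst v)]
      apply integral_congr_ae
      filter_upwards [Lp.coeFn_add a.fst b.fst] with z hz
      rw [hz, Pi.add_apply, add_mul]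
    have h2 : ∫ z in Ω, η z * inner ℝ ((a.snd + b.snd) z) v
        = (∫ z in Ω, η z * inner ℝ (a.snd z) v) + ∫ z in Ω, η z * inner ℝ (b.snd z) v := by
      rw [← integral_add (hη.integrable_mul_inner a.snd v)
        (hη.integrable_mul_inner b.snd v)]
      apply integral_congr_ae
      filter_upwards [Lp.coeFn_add a.snd b.snd] with z hz
      simp only [hz, Pi.add_apply, inner_add_left, mul_add]
    have h3 := ha η hη v
    have h4 := hb η hη v
    change ∫ z in Ω, (a.fst + b.fst) z * fderiv ℝ η z v
      = -∫ z in Ω, η z * inner ℝ ((a.snd + b.snd) z) v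
    rw [h1, h2, h3, h4, neg_add]
  smul_mem' := by
    intro c a ha η hη v
    have h1 : ∫ z in Ω, (c • a.fst) z * fderiv ℝ η z v
        = c * ∫ z in Ω, a.fst z * fderiv ℝ η z v := by
      rw [← integral_const_mul]
      apply integral_congr_ae
      filter_upwards [Lp.coeFn_smul c a.fst] with z hz
      rw [hz, Pi.smul_apply, smul_eq_mul, mul_assoc]
    have h2 : ∫ z in Ω, η z * inner ℝ ((c • a.snd) z) v
        = c * ∫ z in Ω, η z * inner ℝ (a.snd z) v := by
      rw [← integral_const_mul]
      apply integral_congr_ae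
      filter_upwards [Lp.coeFn_smul c a.snd] with z hz
      simp only [hz, Pi.smul_apply, real_inner_smul_left]
      ring
    have h3 := ha η hη v
    change ∫ z in Ω, (c • a.fst) z * fderiv ℝ η z v
      = -∫ z in Ω, η z * inner ℝ ((c • a.snd) z) v
    rw [h1, h2, h3, mul_neg]

/-- The function underlying an element of `W¹₂(Ω)`. -/
def sobolevFun {Ω : Set ℂ} (u : W12 Ω) : Lp ℝ 2 (volume.restrict Ω) := u.1.fst

/-- The weak gradient of an element of `W¹₂(Ω)`. -/
def sobolevGrad {Ω : Set ℂ} (u : W12 Ω) : Lp ℂ 2 (volume.restrict Ω) := u.1.snd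

lemma W12_norm_eq {Ω : Set ℂ} (u : W12 Ω) : ‖u‖ = ‖(sobolevFun u)‖ + ‖(sobolevGrad u)‖ :=
  WithLp.prod_norm_eq_of_L1 u.1

/-- The subspace `C₀^∞(Ω)` of `W¹₂(Ω)`. -/
def testFunctions (Ω : Set ℂ) : Submodule ℝ (W12 Ω) where
  carrier := {u | ∃ η : ℂ → ℝ, IsTestFunction Ω η ∧ (sobolevFun u) =ᵐ[volume.restrict Ω] η}
  zero_mem' := ⟨_, .zero Ω, Lp.coeFn_zero ℝ 2 (volume.restrict Ω)⟩
  add_mem' := by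
    rintro a b ⟨η, hη, ha⟩ ⟨θ, hθ, hb⟩
    refine ⟨_, hη.add hθ, ?_⟩
    filter_upwards [ha, hb, Lp.coeFn_add (sobolevFun a) (sobolevFun b)] with z h1 h2 h3
    rw [← h1, ← h2]
    exact h3
  smul_mem' := by
    rintro c a ⟨η, hη, ha⟩
    refine ⟨_, hη.const_mul c, ?_⟩
    filter_upwards [ha, Lp.coeFn_smul c (sobolevFun a)] with z h1 h2
    rw [← h1]
    exact h2

/-- Every `η ∈ C₀^∞(Ω)` gives an element of `testFunctions Ω`, and its weak gradient is the
classical one. -/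
theorem exists_mem_testFunctions {Ω : Set ℂ} {η : ℂ → ℝ}
    (hη : IsTestFunction Ω η) :
    ∃ u ∈ testFunctions Ω, sobolevFun u =ᵐ[volume.restrict Ω] η ∧
      sobolevGrad u =ᵐ[volume.restrict Ω] fun z => gradient η z := by
  have hgc : Continuous (fun z => gradient η z) :=
    (InnerProductSpace.toDual ℝ ℂ).symm.continuous.comp (hη.contDiff.continuous_fderiv (by simp))
  have hgs : HasCompactSupport (fun z => gradient η z) :=
    (hη.hasCompactSupport.fderiv (𝕜 := ℝ)).comp_left
      (g := fun l => (InnerProductSpace.toDual ℝ ℂ).symm l) (by simp)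
  have hg : MemLp (fun z => gradient η z) 2 (volume.restrict Ω) :=
    (hgc.memLp_of_hasCompactSupport hgs).restrict Ω
  have hw : IsWeakGradient Ω (hη.memLp.toLp η) (hg.toLp _) := by
    intro θ hθ v
    have e1 : ∫ z in Ω, (hη.memLp.toLp η) z * fderiv ℝ θ z v = ∫ z, η z * fderiv ℝ θ z v := by
      rw [← setIntegral_eq_integral_of_forall_compl_eq_zero (s := Ω) (μ := volume)
        (f := fun z => η z * fderiv ℝ θ z v)]
      · apply integral_congr_ae
        filter_upwards [hη.memLp.coeFn_toLp] with z hz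
        rw [hz]
      · intro z hz
        rw [image_eq_zero_of_notMem_tsupport fun hz' => hz (hη.tsupport_subset hz'), zero_mul]
    have e2 : ∫ z in Ω, θ z * inner ℝ ((hg.toLp _) z) v = ∫ z, fderiv ℝ η z v * θ z := by
      rw [← setIntegral_eq_integral_of_forall_compl_eq_zero (s := Ω) (μ := volume)
        (f := fun z => fderiv ℝ η z v * θ z)]
      · apply integral_congr_ae
        filter_upwards [hg.coeFn_toLp] with z hz
        rw [hz]
        unfold gradient
        rw [InnerProductSpace.toDual_symm_apply, mul_comm]
      · intro z hz
        rw [image_eq_zero_of_notMem_tsupport fun hz' => hz (hθ.tsupport_subset hz'), mul_zero]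
    rw [e1, e2]
    have cη := hη.contDiff.continuous
    have cθ := hθ.contDiff.continuous
    have dη : Continuous fun z => fderiv ℝ η z v :=
      (hη.contDiff.continuous_fderiv (by simp)).clm_apply continuous_const
    have dθ : Continuous fun z => fderiv ℝ θ z v :=
      (hθ.contDiff.continuous_fderiv (by simp)).clm_apply continuous_const
    exact integral_mul_fderiv_eq_neg_fderiv_mul_of_integrable
      ((dη.mul cθ).integrable_of_hasCompactSupport hθ.hasCompactSupport.mul_left)
      ((cη.mul dθ).integrable_of_hasCompactSupport hη.hasCompactSupport.mul_right)
      ((cη.mul cθ).integrable_of_hasCompactSupport hη.hasCompactSupport.mul_right)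
      (fun z _ => (hη.contDiff.differentiable (by simp)) z)
      (fun z _ => (hθ.contDiff.differentiable (by simp)) z)
  refine ⟨⟨WithLp.toLp 1 (hη.memLp.toLp η, hg.toLp _), hw⟩, ?_, hη.memLp.coeFn_toLp,
    hg.coeFn_toLp⟩
  exact ⟨η, hη, hη.memLp.coeFn_toLp⟩

/-- `W̊¹₂(Ω)`: the closure of `C₀^∞(Ω)` in the norm of `W¹₂(Ω)`. -/
def W12Zero (Ω : Set ℂ) : Submodule ℝ (W12 Ω) := (testFunctions Ω).topologicalClosure

/-- `φ` restricts to a conformal homeomorphism of the open set `Ω` onto the open unit disc, that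
is, to a holomorphic bijection. -/
structure IsConformalOntoDisc (Ω : Set ℂ) (φ : ℂ → ℂ) : Prop where
  differentiableOn : DifferentiableOn ℂ φ Ω
  bijOn : BijOn φ Ω (Metric.ball 0 1)

/-- The measure `h(z) dμ(z)` on `Ω`, where `h(z) = |φ'(z)|²` is the conformal weight
and `μ` is the Lebesgue measure. -/
def conformalMeasure (Ω : Set ℂ) (φ : ℂ → ℂ) : Measure ℂ :=
  (volume.restrict Ω).withDensity fun z => ENNReal.ofReal (‖deriv φ z‖ ^ 2)

/-- On an open set, an element of `W¹₂(Ω)` is determined by its underlying function. -/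
lemma W12_ext {Ω : Set ℂ} (hΩ : IsOpen Ω) {u w : W12 Ω} (h : (sobolevFun u) = (sobolevFun w)) : u = w := by
  have key : ∀ v : ℂ, ∀ᵐ z ∂(volume.restrict Ω), inner ℝ ((sobolevGrad u) z - (sobolevGrad w) z) v = 0 := by
    intro v
    rw [ae_restrict_iff' hΩ.measurableSet]
    have hm : MemLp (fun z => inner ℝ ((sobolevGrad u) z - (sobolevGrad w) z) v) 2 (volume.restrict Ω) :=
      ((Lp.memLp (sobolevGrad u)).sub (Lp.memLp (sobolevGrad w))).inner_const v
    refine hΩ.ae_eq_zero_of_integral_contDiff_smul_eq_zero (μ := volume) ?_ ?_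
    · exact locallyIntegrableOn_of_locallyIntegrable_restrict
        (hm.locallyIntegrable (by norm_num))
    · intro η h1 h2 h3
      have hη : IsTestFunction Ω η := ⟨h1, h2, h3⟩
      have hu := u.2 η hη v
      have hw := w.2 η hη v
      change ∫ z in Ω, (sobolevFun u) z * fderiv ℝ η z v = -∫ z in Ω, η z * inner ℝ ((sobolevGrad u) z) v at hu
      change ∫ z in Ω, (sobolevFun w) z * fderiv ℝ η z v = -∫ z in Ω, η z * inner ℝ ((sobolevGrad w) z) v at hw
      rw [h, hw, neg_inj] at hu
      rw [← setIntegral_eq_integral_of_forall_compl_eq_zero (s := Ω)]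
      · simp only [inner_sub_left, smul_eq_mul, mul_sub]
        rw [integral_sub (hη.integrable_mul_inner (sobolevGrad u) v)
          (hη.integrable_mul_inner (sobolevGrad w) v), hu, sub_self]
      · intro z hz
        have : η z = 0 := image_eq_zero_of_notMem_tsupport fun hz' => hz (h3 hz')
        simp [this]
  have hg : (sobolevGrad u) = (sobolevGrad w) := by
    apply Lp.ext
    filter_upwards [key 1, key Complex.I] with z h1 h2
    apply sub_eq_zero.1
    apply Complex.ext
    · simpa [Complex.inner] using h1
    · have h3 : -(sobolevGrad w z).im + (sobolevGrad u z).im = 0 := by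
        simpa [Complex.inner] using h2
      rw [Complex.sub_im, Complex.zero_im]
      linarith
  apply Subtype.ext
  exact WithLp.ofLp_injective 1 (Prod.ext h hg)

end

noncomputable section

open scoped Topology NNReal

/-! Both halves of the theorem are facts about the unit disc, carried to `Ω` by `φ`. In the plane
the Dirichlet integral is conformally invariant (`IsConformalOntoDisc.eLpNorm_fderiv_eq`), and the
Jacobian of `φ` is exactly the weight `h`, so the weighted `Lʳ` norm on `Ω` becomes the plain `Lʳ`
norm on the disc (`IsConformalOntoDisc.eLpNorm_eq`). A test function transplanted by `φ` is a `C¹`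
function with compact support in the disc (`IsTestFunction.exists_transplant`).

Boundedness is then the Sobolev inequality on the disc (`exists_eLpNorm_le_eLpNorm_fderiv_two`),
passed to the closure by Fatou's lemma.

Compactness is first obtained quantitatively in `L¹`. Cutting the disc by a fine grid and applying
the Poincaré inequality on each square bounds the `L¹` norm by finitely many integrals over squares
plus a small multiple of the Dirichlet norm (`exists_finset_eLpNorm_one_le`). Interpolating `Lʳ`
between `L¹` and `L²ʳ⁻¹` (`eLpNorm_rpow_le_mul`), with boundedness at the upper exponent, makes the
`Lʳ` norm small wherever a finite-rank operator is small;
`isCompactOperator_of_forall_exists_finiteRank` turns this into compactness. -/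

/-! ### Injective holomorphic maps and their inverses. -/

/-- A left inverse of a holomorphic function on an open set is holomorphic on its image. -/
theorem differentiableAt_of_leftInvOn {Ω : Set ℂ} (hΩ : IsOpen Ω) {φ ψ : ℂ → ℂ}
    (hd : DifferentiableOn ℂ φ Ω) (hinv : LeftInvOn ψ φ Ω) {z₀ : ℂ} (hz₀ : z₀ ∈ Ω) :
    DifferentiableAt ℂ ψ (φ z₀) := by
  -- Open mapping theorem; its alternative, `φ` locally constant, contradicts injectivity.
  have hopen : ∀ z ∈ Ω, 𝓝 (φ z) ≤ (𝓝 z).map φ := by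
    intro z hz
    refine ((hd.analyticAt (hΩ.mem_nhds hz)).eventually_constant_or_nhds_le_map_nhds).resolve_left
      fun hc => ?_
    have h1 : ∀ᶠ y in 𝓝 z, y = z := by
      filter_upwards [hc, hΩ.mem_nhds hz] with y hy hyΩ
      exact hinv.injOn hyΩ hz hy
    have h2 : ∀ᶠ y in 𝓝[≠] z, y = z := h1.filter_mono nhdsWithin_le_nhds
    obtain ⟨y, hy, hy'⟩ := (h2.and self_mem_nhdsWithin).exists
    exact hy' hy
  have hcont : ∀ z ∈ Ω, ContinuousAt ψ (φ z) := by
    intro z hz V hV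
    rw [hinv hz] at hV
    have h1 : φ '' (V ∩ Ω) ∈ 𝓝 (φ z) :=
      hopen z hz (Filter.image_mem_map (Filter.inter_mem hV (hΩ.mem_nhds hz)))
    refine Filter.mem_map.2 (Filter.mem_of_superset h1 ?_)
    rintro _ ⟨y, ⟨hyV, hyΩ⟩, rfl⟩
    simpa [hinv hyΩ] using hyV
  have hdiff : ∀ z ∈ Ω, deriv φ z ≠ 0 → DifferentiableAt ℂ ψ (φ z) := by
    intro z hz hne
    refine HasDerivAt.differentiableAt (f' := (deriv φ z)⁻¹) ?_
    refine HasDerivAt.of_local_left_inverse (f := φ) (hcont z hz) ?_ hne ?_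
    · rw [hinv hz]
      exact (hd.differentiableAt (hΩ.mem_nhds hz)).hasDerivAt
    · refine Filter.mem_of_superset (hopen z hz (Filter.image_mem_map (hΩ.mem_nhds hz))) ?_
      rintro _ ⟨y, hy, rfl⟩
      simp [hinv hy]
  -- Zeros of the derivative are isolated, since otherwise `φ` would be constant on a ball, again
  -- against injectivity.
  have hpunct : ∀ᶠ z in 𝓝[≠] z₀, deriv φ z ≠ 0 := by
    have hda : AnalyticAt ℂ (deriv φ) z₀ := (hd.analyticAt (hΩ.mem_nhds hz₀)).deriv
    refine (hda.eventually_eq_zero_or_eventually_ne_zero).resolve_left fun hz => ?_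
    obtain ⟨ε, hε, hball⟩ := Metric.eventually_nhds_iff_ball.1 (hz.and (hΩ.mem_nhds hz₀))
    have hconst : ∀ y ∈ Metric.ball z₀ ε, φ y = φ z₀ := fun y hy =>
      (convex_ball z₀ ε).is_const_of_fderivWithin_eq_zero (𝕜 := ℂ)
        (hd.mono fun y hy => (hball y hy).2)
        (fun y hy => by
          rw [fderivWithin_of_isOpen Metric.isOpen_ball hy]
          ext
          simpa using (hball y hy).1) hy (Metric.mem_ball_self hε)
    have h1 : ∀ᶠ y in 𝓝 z₀, y = z₀ := by
      filter_upwards [Metric.ball_mem_nhds z₀ hε] with y hy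
      exact hinv.injOn (hball y hy).2 hz₀ (hconst y hy)
    have h2 : ∀ᶠ y in 𝓝[≠] z₀, y = z₀ := h1.filter_mono nhdsWithin_le_nhds
    obtain ⟨y, hy, hy'⟩ := (h2.and self_mem_nhdsWithin).exists
    exact hy' hy
  rw [eventually_nhdsWithin_iff] at hpunct
  have hV : φ '' ({z | z ≠ z₀ → deriv φ z ≠ 0} ∩ Ω) ∈ 𝓝 (φ z₀) :=
    hopen z₀ hz₀ (Filter.image_mem_map (Filter.inter_mem hpunct (hΩ.mem_nhds hz₀)))
  -- Removable singularity: `ψ` is continuous at `φ z₀` and holomorphic at the nearby points, so a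
  -- possible zero of the derivative at `z₀` does no harm.
  refine ((Complex.differentiableOn_compl_singleton_and_continuousAt_iff hV).1
    ⟨?_, hcont z₀ hz₀⟩).differentiableAt hV
  rintro _ ⟨⟨z, ⟨hz, hzΩ⟩, rfl⟩, hne⟩
  exact (hdiff z hzΩ (hz fun h => hne (by rw [h]; rfl))).differentiableWithinAt

/-- Chain rule in `ψ ∘ φ = id`: the product of the two derivatives is 1. -/
theorem deriv_ne_zero_of_leftInvOn {Ω : Set ℂ} (hΩ : IsOpen Ω) {φ ψ : ℂ → ℂ}
    (hd : DifferentiableOn ℂ φ Ω) (hinv : LeftInvOn ψ φ Ω) {z₀ : ℂ} (hz₀ : z₀ ∈ Ω) :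
    deriv φ z₀ ≠ 0 := by
  intro h0
  have h1 := (differentiableAt_of_leftInvOn hΩ hd hinv hz₀).hasDerivAt.comp z₀
    (hd.differentiableAt (hΩ.mem_nhds hz₀)).hasDerivAt
  have h2 : HasDerivAt (ψ ∘ φ) 1 z₀ := by
    refine (hasDerivAt_id z₀).congr_of_eventuallyEq ?_
    filter_upwards [hΩ.mem_nhds hz₀] with z hz
    exact hinv hz
  have := h1.unique h2
  simp [h0] at this

theorem IsConformalOntoDisc.deriv_ne_zero {Ω : Set ℂ} (hΩ : IsOpen Ω) {φ : ℂ → ℂ}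
    (hφ : IsConformalOntoDisc Ω φ) {z : ℂ} (hz : z ∈ Ω) : deriv φ z ≠ 0 :=
  deriv_ne_zero_of_leftInvOn hΩ hφ.differentiableOn hφ.bijOn.injOn.leftInvOn_invFunOn hz

/-! ### Change of variables and conformal invariance. -/

theorem IsConformalOntoDisc.hasFDerivAt {Ω : Set ℂ} (hΩ : IsOpen Ω) {φ : ℂ → ℂ}
    (hφ : IsConformalOntoDisc Ω φ) {z : ℂ} (hz : z ∈ Ω) :
    HasFDerivAt φ ((ContinuousLinearMap.toSpanSingleton ℂ (deriv φ z)).restrictScalars ℝ) z :=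
  (hφ.differentiableOn.differentiableAt (hΩ.mem_nhds hz)).hasDerivAt.hasFDerivAt.restrictScalars ℝ

theorem abs_det_restrictScalars_toSpanSingleton (c : ℂ) :
    |((ContinuousLinearMap.toSpanSingleton ℂ c).restrictScalars ℝ).det| = ‖c‖ ^ 2 := by
  simp [ContinuousLinearMap.det, LinearMap.det_restrictScalars, Algebra.norm_complex_apply,
    Complex.normSq_eq_norm_sq]

/-- Multiplication by `c` stretches every direction equally, hence equality. Squared, the factor
matches the determinant `‖c‖ ^ 2`, which is what makes the Dirichlet integral invariant. -/
theorem norm_comp_restrictScalars_toSpanSingleton (L : ℂ →L[ℝ] ℝ) (c : ℂ) :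
    ‖L.comp ((ContinuousLinearMap.toSpanSingleton ℂ c).restrictScalars ℝ)‖ = ‖L‖ * ‖c‖ := by
  rcases eq_or_ne c 0 with rfl | hc
  · simp [ContinuousLinearMap.toSpanSingleton_zero]
  apply le_antisymm
  · refine ContinuousLinearMap.opNorm_le_bound _ (by positivity) fun x => ?_
    calc ‖L (x • c)‖ ≤ ‖L‖ * ‖x • c‖ := L.le_opNorm _
      _ = ‖L‖ * ‖c‖ * ‖x‖ := by rw [norm_smul]; ring
  · rw [← le_div_iff₀ (norm_pos_iff.2 hc)]
    refine ContinuousLinearMap.opNorm_le_bound _ (by positivity) fun x => ?_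
    have h := (L.comp ((ContinuousLinearMap.toSpanSingleton ℂ c).restrictScalars ℝ)).le_opNorm
      (x / c)
    have h1 : (L.comp ((ContinuousLinearMap.toSpanSingleton ℂ c).restrictScalars ℝ)) (x / c)
        = L x := by
      simp [div_mul_cancel₀ x hc]
    rw [h1, norm_div] at h
    refine h.trans_eq (by ring)

/-- Change of variables under a conformal map onto the disc. -/
theorem IsConformalOntoDisc.lintegral_comp {Ω : Set ℂ} (hΩ : IsOpen Ω) {φ : ℂ → ℂ}
    (hφ : IsConformalOntoDisc Ω φ) (g : ℂ → ℝ≥0∞) :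
    ∫⁻ z in Ω, ENNReal.ofReal (‖deriv φ z‖ ^ 2) * g (φ z) = ∫⁻ w in Metric.ball 0 1, g w := by
  rw [← hφ.bijOn.image_eq, lintegral_image_eq_lintegral_abs_det_fderiv_mul volume hΩ.measurableSet
    (fun z hz => (hφ.hasFDerivAt hΩ hz).hasFDerivWithinAt) hφ.bijOn.injOn]
  simp_rw [abs_det_restrictScalars_toSpanSingleton]

theorem lintegral_conformalMeasure (Ω : Set ℂ) (φ : ℂ → ℂ) (g : ℂ → ℝ≥0∞) :
    ∫⁻ z, g z ∂(conformalMeasure Ω φ) =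
      ∫⁻ z in Ω, ENNReal.ofReal (‖deriv φ z‖ ^ 2) * g z := by
  rw [conformalMeasure, lintegral_withDensity_eq_lintegral_mul_non_measurable]
  · simp
  · exact ((measurable_deriv φ).norm.pow_const 2).ennreal_ofReal
  · simp

theorem conformalMeasure_absolutelyContinuous (Ω : Set ℂ) (φ : ℂ → ℂ) :
    conformalMeasure Ω φ ≪ volume.restrict Ω :=
  withDensity_absolutelyContinuous _ _

theorem IsConformalOntoDisc.absolutelyContinuous_conformalMeasure {Ω : Set ℂ} (hΩ : IsOpen Ω)
    {φ : ℂ → ℂ} (hφ : IsConformalOntoDisc Ω φ) :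
    volume.restrict Ω ≪ conformalMeasure Ω φ := by
  refine withDensity_absolutelyContinuous'
    ((measurable_deriv φ).norm.pow_const 2).ennreal_ofReal.aemeasurable ?_
  filter_upwards [ae_restrict_mem hΩ.measurableSet] with z hz
  have := hφ.deriv_ne_zero hΩ hz
  simp [this]

/-- A test function on `Ω`, transplanted to the disc by a conformal map. -/
theorem IsTestFunction.exists_transplant {Ω : Set ℂ} (hΩ : IsOpen Ω) {φ : ℂ → ℂ}
    (hφ : IsConformalOntoDisc Ω φ) {η : ℂ → ℝ} (hη : IsTestFunction Ω η) :
    ∃ v : ℂ → ℝ, ContDiff ℝ 1 v ∧ tsupport v ⊆ Metric.ball 0 1 ∧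
      ∀ z ∈ Ω, v (φ z) = η z := by
  set ψ := Function.invFunOn φ Ω
  have hinv : LeftInvOn ψ φ Ω := hφ.bijOn.injOn.leftInvOn_invFunOn
  have hK : IsCompact (φ '' tsupport η) :=
    hη.hasCompactSupport.isCompact.image_of_continuousOn
      (hφ.differentiableOn.continuousOn.mono hη.tsupport_subset)
  have hKsub : φ '' tsupport η ⊆ Metric.ball 0 1 := by
    rw [← hφ.bijOn.image_eq]
    exact image_mono hη.tsupport_subset
  -- Extension by zero is smooth across the unit circle because `v` vanishes off the compact set `φ
  -- '' tsupport η`, which stays inside the disc.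
  set v : ℂ → ℝ := (Metric.ball (0 : ℂ) 1).indicator (η ∘ ψ) with hv
  have hvφ : ∀ z ∈ Ω, v (φ z) = η z := by
    intro z hz
    rw [hv, indicator_of_mem (hφ.bijOn.mapsTo hz), Function.comp_apply, hinv hz]
  have hv0 : ∀ w ∉ φ '' tsupport η, v w = 0 := by
    intro w hw
    by_cases hwb : w ∈ Metric.ball (0 : ℂ) 1
    · obtain ⟨z, hz, rfl⟩ := hφ.bijOn.surjOn hwb
      rw [hvφ z hz]
      exact image_eq_zero_of_notMem_tsupport fun h => hw ⟨z, h, rfl⟩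
    · exact indicator_of_notMem hwb _
  have hsupp : tsupport v ⊆ φ '' tsupport η :=
    closure_minimal (fun w hw => by_contra fun h => hw (hv0 w h)) hK.isClosed
  refine ⟨v, ?_, hsupp.trans hKsub, hvφ⟩
  rw [contDiff_iff_contDiffAt]
  intro w
  by_cases hwb : w ∈ Metric.ball (0 : ℂ) 1
  · have hψ : DifferentiableOn ℂ ψ (Metric.ball 0 1) := by
      intro y hy
      obtain ⟨z, hz, rfl⟩ := hφ.bijOn.surjOn hy
      exact (differentiableAt_of_leftInvOn hΩ hφ.differentiableOn hinv
        hz).differentiableWithinAt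
    have h1 : ContDiffAt ℝ 1 ψ w :=
      ((hψ.analyticAt (Metric.isOpen_ball.mem_nhds hwb)).contDiffAt (n := 1)).restrict_scalars ℝ
    refine ((hη.contDiff.contDiffAt.of_le (by simp)).comp w h1).congr_of_eventuallyEq ?_
    filter_upwards [Metric.isOpen_ball.mem_nhds hwb] with y hy
    exact indicator_of_mem hy _
  · refine (contDiffAt_const (c := (0 : ℝ))).congr_of_eventuallyEq ?_
    filter_upwards [hK.isClosed.isOpen_compl.mem_nhds fun h => hwb (hKsub h)] with y hy
    exact hv0 y hy

theorem IsConformalOntoDisc.eLpNorm_eq {Ω : Set ℂ} (hΩ : IsOpen Ω) {φ : ℂ → ℂ}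
    (hφ : IsConformalOntoDisc Ω φ) {η v : ℂ → ℝ} (hv : ∀ z ∈ Ω, v (φ z) = η z)
    {r : ℝ≥0∞} (hr0 : r ≠ 0) (hr : r ≠ ⊤) :
    eLpNorm η r (conformalMeasure Ω φ) = eLpNorm v r (volume.restrict (Metric.ball 0 1)) := by
  rw [eLpNorm_eq_lintegral_rpow_enorm_toReal hr0 hr, eLpNorm_eq_lintegral_rpow_enorm_toReal hr0 hr,
    lintegral_conformalMeasure, ← hφ.lintegral_comp hΩ]
  congr 1
  refine setLIntegral_congr_fun hΩ.measurableSet fun z hz => ?_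
  simp only [hv z hz]

/-- Conformal invariance of the Dirichlet integral. -/
theorem IsConformalOntoDisc.eLpNorm_fderiv_eq {Ω : Set ℂ} (hΩ : IsOpen Ω) {φ : ℂ → ℂ}
    (hφ : IsConformalOntoDisc Ω φ) {η v : ℂ → ℝ} (hv : ∀ z ∈ Ω, v (φ z) = η z)
    (hvd : Differentiable ℝ v) :
    eLpNorm (fderiv ℝ η) 2 (volume.restrict Ω) =
      eLpNorm (fderiv ℝ v) 2 (volume.restrict (Metric.ball 0 1)) := by
  rw [eLpNorm_eq_lintegral_rpow_enorm_toReal (by simp) (by simp),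
    eLpNorm_eq_lintegral_rpow_enorm_toReal (by simp) (by simp), ← hφ.lintegral_comp hΩ]
  congr 1
  refine setLIntegral_congr_fun hΩ.measurableSet fun z hz => ?_
  have h1 : fderiv ℝ η z = (fderiv ℝ v (φ z)).comp
      ((ContinuousLinearMap.toSpanSingleton ℂ (deriv φ z)).restrictScalars ℝ) := by
    refine HasFDerivAt.fderiv ?_
    refine ((hvd (φ z)).hasFDerivAt.comp z (hφ.hasFDerivAt hΩ hz)).congr_of_eventuallyEq ?_
    filter_upwards [hΩ.mem_nhds hz] with y hy
    exact (hv y hy).symm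
  simp only [h1, ENNReal.toReal_ofNat, ENNReal.rpow_ofNat]
  rw [← ofReal_norm, norm_comp_restrictScalars_toSpanSingleton, ← ofReal_norm,
    ← ENNReal.ofReal_pow (by positivity), ← ENNReal.ofReal_pow (by positivity),
    ← ENNReal.ofReal_mul (by positivity)]
  congr 1
  ring

/-- Change of variables for averages under a conformal map onto the disc. -/
theorem IsConformalOntoDisc.setIntegral_conformalMeasure {Ω : Set ℂ} (hΩ : IsOpen Ω)
    {φ : ℂ → ℂ} (hφ : IsConformalOntoDisc Ω φ) {η v : ℂ → ℝ} (hv : ∀ z ∈ Ω, v (φ z) = η z)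
    {Q : Set ℂ} (hQ : MeasurableSet Q) :
    ∫ z in Ω ∩ φ ⁻¹' Q, η z ∂(conformalMeasure Ω φ) = ∫ w in Metric.ball 0 1 ∩ Q, v w := by
  -- Outside `Ω` nothing is known of `φ`, so measurability goes through its extension by zero.
  obtain ⟨T, hT, hTeq⟩ : ∃ T, MeasurableSet T ∧ Ω ∩ φ ⁻¹' Q = T := ⟨_, by
    have : Measurable (Ω.indicator φ) := by
      classical
      rw [← piecewise_eq_indicator]
      exact hφ.differentiableOn.continuousOn.measurable_piecewise continuousOn_const
        hΩ.measurableSet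
    convert hΩ.measurableSet.inter (this hQ) using 1
    ext z
    constructor
    · rintro ⟨h1, h2⟩
      exact ⟨h1, by simpa [h1] using h2⟩
    · rintro ⟨h1, h2⟩
      exact ⟨h1, by simpa [h1] using h2⟩, rfl⟩
  have hTΩ : T ⊆ Ω := hTeq ▸ inter_subset_left
  have himage : φ '' T = Metric.ball 0 1 ∩ Q := by
    rw [← hTeq, image_inter_preimage, hφ.bijOn.image_eq]
  rw [hTeq, ← himage, integral_image_eq_integral_abs_det_fderiv_smul volume hT
    (fun z hz => (hφ.hasFDerivAt hΩ (hTΩ hz)).hasFDerivWithinAt) (hφ.bijOn.injOn.mono hTΩ),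
    conformalMeasure, setIntegral_withDensity_eq_setIntegral_toReal_smul
      ((measurable_deriv φ).norm.pow_const 2).ennreal_ofReal (by simp) _ hT,
    Measure.restrict_restrict hT, inter_eq_left.2 hTΩ]
  refine setIntegral_congr_fun hT fun z hz => ?_
  simp only [abs_det_restrictScalars_toSpanSingleton, hv z (hTΩ hz)]
  rw [ENNReal.toReal_ofReal (by positivity)]

/-! ### The Sobolev inequality on bounded plane sets. -/

theorem eLpNorm_restrict_eq_of_support_subset_of_normed {α F : Type*} [MeasurableSpace α]
    [NormedAddCommGroup F] (μ : Measure α) {v : α → F} {B : Set α}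
    (hvB : Function.support v ⊆ B) (p : ℝ≥0∞) :
    eLpNorm v p (μ.restrict B) = eLpNorm v p μ :=
  eLpNorm_restrict_eq_of_support_subset hvB

theorem eLpNorm_fderiv_restrict_eq {E F : Type*} [NormedAddCommGroup E] [NormedSpace ℝ E]
    [MeasurableSpace E] [NormedAddCommGroup F] [NormedSpace ℝ F] (μ : Measure E) {v : E → F}
    {B : Set E} (hvB : tsupport v ⊆ B) (p : ℝ≥0∞) :
    eLpNorm (fderiv ℝ v) p (μ.restrict B) = eLpNorm (fderiv ℝ v) p μ := by
  have h : Function.support (fderiv ℝ v) ⊆ B := (support_fderiv_subset ℝ).trans hvB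
  exact eLpNorm_restrict_eq_of_support_subset_of_normed μ h p

theorem exists_sobolev_exponent (r : ℝ≥0) (hr : 1 ≤ r) :
    ∃ p : ℝ≥0, 1 ≤ p ∧ p < 2 ∧ (p : ℝ)⁻¹ - 2⁻¹ ≤ (r : ℝ)⁻¹ := by
  have hr' : (1 : ℝ) ≤ r := by exact_mod_cast hr
  -- Solves `1/p - 1/2 = 1/(r + 2)`: the Sobolev conjugate of `p` is `r + 2`, slightly above `r`.
  refine ⟨2 * (r + 2) / (r + 4), ?_, ?_, ?_⟩
  · rw [one_le_div (by positivity), ← NNReal.coe_le_coe]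
    push_cast
    linarith
  · rw [div_lt_iff₀ (by positivity), ← NNReal.coe_lt_coe]
    push_cast
    linarith
  · push_cast
    rw [inv_div, ← sub_nonneg]
    have : (r : ℝ)⁻¹ - ((r + 4) / (2 * (r + 2)) - 2⁻¹) = 2 / (r * (r + 2)) := by
      field_simp
      ring
    rw [this]
    positivity

theorem exists_eLpNorm_le_eLpNorm_fderiv_of_le {p r : ℝ≥0} (hp1 : 1 ≤ p) (hp2 : p < 2)
    (hpr : (p : ℝ)⁻¹ - 2⁻¹ ≤ (r : ℝ)⁻¹) {B : Set ℂ} (hB : Bornology.IsBounded B) :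
    ∃ M : ℝ≥0, ∀ v : ℂ → ℝ, ContDiff ℝ 1 v → Function.support v ⊆ B →
      eLpNorm v r volume ≤ M * eLpNorm (fderiv ℝ v) p volume := by
  refine ⟨eLpNormLESNormFDerivOfLeConst ℝ (volume : Measure ℂ) B p r, fun v hv hvB => ?_⟩
  refine eLpNorm_le_eLpNorm_fderiv_of_le volume hv hvB hp1 ?_ ?_ hB
  · rw [Complex.finrank_real_complex]
    exact_mod_cast hp2
  · rw [Complex.finrank_real_complex]
    exact_mod_cast hpr

/-- The Gagliardo–Nirenberg–Sobolev inequality on a bounded set of the plane, in the critical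
case `p = 2`. -/
theorem exists_eLpNorm_le_eLpNorm_fderiv_two {B : Set ℂ} (hB : Bornology.IsBounded B) (r : ℝ≥0)
    (hr : 1 ≤ r) :
    ∃ C : ℝ≥0, ∀ v : ℂ → ℝ, ContDiff ℝ 1 v → tsupport v ⊆ B →
      eLpNorm v r (volume.restrict B) ≤ C * eLpNorm (fderiv ℝ v) 2 (volume.restrict B) := by
  obtain ⟨p, hp1, hp2, hpr⟩ := exists_sobolev_exponent r hr
  have : IsFiniteMeasure (volume.restrict B) :=
    ⟨by rw [Measure.restrict_apply_univ]; exact hB.measure_lt_top⟩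
  obtain ⟨M, hM⟩ := exists_eLpNorm_le_eLpNorm_fderiv_of_le hp1 hp2 hpr hB
  have hp2' : (p : ℝ≥0∞) ≤ 2 := by exact_mod_cast hp2.le
  -- The Hölder constant from `L²` down to `Lᵖ` on `B`; the detour through `p < 2` is needed because
  -- the Sobolev inequality used here requires `p` below the dimension.
  set N : ℝ≥0∞ := (volume.restrict B) univ ^ (1 / (p : ℝ≥0∞).toReal - 1 / (2 : ℝ≥0∞).toReal)
    with hN
  have hNt : N ≠ ⊤ := by
    refine ENNReal.rpow_ne_top_of_nonneg ?_ (measure_ne_top _ _)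
    simp only [ENNReal.coe_toReal, ENNReal.toReal_ofNat, sub_nonneg]
    exact one_div_le_one_div_of_le (by positivity) (by exact_mod_cast hp2.le)
  refine ⟨M * N.toNNReal, fun v hv hvB => ?_⟩
  have h2 := eLpNorm_fderiv_restrict_eq volume hvB p
  have h3 := eLpNorm_le_eLpNorm_mul_rpow_measure_univ (μ := volume.restrict B) hp2'
    (hv.continuous_fderiv (by simp)).aestronglyMeasurable
  rw [h2, mul_comm] at h3
  rw [eLpNorm_restrict_eq_of_support_subset ((subset_tsupport v).trans hvB), ENNReal.coe_mul,
    mul_assoc, ENNReal.coe_toNNReal hNt]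
  exact (hM v hv ((subset_tsupport v).trans hvB)).trans (by gcongr)

/-! ### The Poincaré inequality on squares and on a grid. -/

/-- The Poincaré inequality in `L¹` on a square of side `ε`. -/
theorem lintegral_square_le {g g₁ g₂ : ℝ × ℝ → ℝ} (hg : Continuous g) (hg₁ : Continuous g₁)
    (hg₂ : Continuous g₂)
    (hd₁ : ∀ x y, HasDerivAt (fun t => g (t, y)) (g₁ (x, y)) x)
    (hd₂ : ∀ x y, HasDerivAt (fun t => g (x, t)) (g₂ (x, y)) y)
    {I J : Set ℝ} {a b ε : ℝ} (hε : 0 < ε) (hI : I = Ioc a (a + ε)) (hJ : J = Ioc b (b + ε)) :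
    ∫⁻ x in I ×ˢ J, ‖g x‖ₑ ≤ ‖∫ x in I ×ˢ J, g x‖ₑ +
      ENNReal.ofReal ε * ((∫⁻ x in I ×ˢ J, ‖g₁ x‖ₑ) + ∫⁻ x in I ×ˢ J, ‖g₂ x‖ₑ) := by
  have hIm : MeasurableSet I := hI ▸ measurableSet_Ioc
  have hJm : MeasurableSet J := hJ ▸ measurableSet_Ioc
  have hQm : MeasurableSet (I ×ˢ J) := hIm.prod hJm
  set e := ENNReal.ofReal ε with he
  have he0 : e ≠ 0 := by simpa [he] using hε
  have het : e ≠ ⊤ := ENNReal.ofReal_ne_top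
  have hvI : volume I = e := by simp [hI, he]
  have hvJ : volume J = e := by simp [hJ, he]
  have hvQ : volume (I ×ˢ J) = e * e := by
    rw [Measure.volume_eq_prod, Measure.prod_prod, hvI, hvJ]
  have hprod : (volume : Measure (ℝ × ℝ)).restrict (I ×ˢ J) =
      (volume.restrict I).prod (volume.restrict J) := by
    rw [Measure.volume_eq_prod, Measure.prod_restrict]
  have : IsFiniteMeasure ((volume : Measure (ℝ × ℝ)).restrict (I ×ˢ J)) :=
    ⟨by rw [Measure.restrict_apply_univ, hvQ]; finiteness⟩
  have hint : IntegrableOn g (I ×ˢ J) := by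
    refine (hg.continuousOn.integrableOn_compact
      (isCompact_Icc.prod isCompact_Icc : IsCompact (Icc a (a + ε) ×ˢ Icc b (b + ε)))).mono_set ?_
    rw [hI, hJ]
    exact prod_mono Ioc_subset_Icc_self Ioc_subset_Icc_self
  have ftc : ∀ (f f' : ℝ → ℝ) (c : ℝ) (S : Set ℝ), S = Ioc c (c + ε) → Continuous f' →
      (∀ t, HasDerivAt f (f' t) t) → ∀ s ∈ S, ∀ t ∈ S, ‖f s - f t‖ₑ ≤ ∫⁻ u in S, ‖f' u‖ₑ := by
    intro f f' c S hS hf' hf s hs t ht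
    have h1 : f s - f t = ∫ u in t..s, f' u :=
      (intervalIntegral.integral_eq_sub_of_hasDerivAt (fun u _ => hf u)
        (hf'.intervalIntegrable _ _)).symm
    have h2 : ‖f s - f t‖ₑ = ‖∫ u in uIoc t s, f' u‖ₑ := by
      rw [h1, ← ofReal_norm, ← ofReal_norm, intervalIntegral.norm_intervalIntegral_eq]
    rw [h2]
    refine (enorm_integral_le_lintegral_enorm _).trans (lintegral_mono_set ?_)
    rw [hS] at hs ht ⊢
    intro u hu
    rw [mem_uIoc] at hu
    rcases hu with hu | hu
    · exact ⟨ht.1.trans hu.1, hu.2.trans hs.2⟩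
    · exact ⟨hs.1.trans hu.1, hu.2.trans ht.2⟩
  set α : ℝ → ℝ≥0∞ := fun y => ∫⁻ t in I, ‖g₁ (t, y)‖ₑ with hα
  set β : ℝ → ℝ≥0∞ := fun x => ∫⁻ t in J, ‖g₂ (x, t)‖ₑ with hβ
  have hm₁ : Measurable fun p : ℝ × ℝ => ‖g₁ p‖ₑ := hg₁.measurable.enorm
  have hm₂ : Measurable fun p : ℝ × ℝ => ‖g₂ p‖ₑ := hg₂.measurable.enorm
  have hmα : Measurable α := hm₁.lintegral_prod_left'
  have hmβ : Measurable β := hm₂.lintegral_prod_right'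
  have hIα : ∫⁻ y in J, α y = ∫⁻ x in I ×ˢ J, ‖g₁ x‖ₑ := by
    rw [hprod, lintegral_prod_symm' _ hm₁]
  have hIβ : ∫⁻ x in I, β x = ∫⁻ x in I ×ˢ J, ‖g₂ x‖ₑ := by
    rw [hprod, lintegral_prod _ hm₂.aemeasurable]
  -- Join `p` to `q` by a horizontal segment at height `p.2`, then a vertical one at abscissa `q.1`.
  -- Each bound depends on one coordinate only, so integrating it over the other gives a factor `ε`.
  have hosc : ∀ p ∈ I ×ˢ J, ∀ q ∈ I ×ˢ J, ‖g p - g q‖ₑ ≤ α p.2 + β q.1 := by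
    rintro ⟨x, y⟩ ⟨hx, hy⟩ ⟨x', y'⟩ ⟨hx', hy'⟩
    have h1 := ftc (fun t => g (t, y)) (fun t => g₁ (t, y)) a I hI
      (hg₁.comp (by fun_prop)) (fun t => hd₁ t y) x hx x' hx'
    have h2 := ftc (fun t => g (x', t)) (fun t => g₂ (x', t)) b J hJ
      (hg₂.comp (by fun_prop)) (fun t => hd₂ x' t) y hy y' hy'
    calc ‖g (x, y) - g (x', y')‖ₑ = ‖(g (x, y) - g (x', y)) + (g (x', y) - g (x', y'))‖ₑ := by
          congr 1; ring
      _ ≤ _ := (enorm_add_le _ _).trans (add_le_add h1 h2)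
  -- Average over `q`; `htot` then integrates over `p`, and the area `e * e` cancels.
  have hpt : ∀ p ∈ I ×ˢ J, e * e * ‖g p‖ₑ ≤
      ‖∫ q in I ×ˢ J, g q‖ₑ + (e * e * α p.2 + e * ∫⁻ x in I ×ˢ J, ‖g₂ x‖ₑ) := by
    intro p hp
    have h1 : ∫ q in I ×ˢ J, (g p - g q) = ε * ε * g p - ∫ q in I ×ˢ J, g q := by
      rw [integral_sub (integrable_const (g p)) hint, setIntegral_const]
      simp [measureReal_def, hvQ, he, hε.le]
    have h2 : ε * ε * g p = (∫ q in I ×ˢ J, g q) + ∫ q in I ×ˢ J, (g p - g q) := by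
      rw [h1]; ring
    have h3 : e * e * ‖g p‖ₑ = ‖ε * ε * g p‖ₑ := by
      rw [enorm_mul, enorm_mul, Real.enorm_eq_ofReal hε.le]
    rw [h3, h2]
    refine (enorm_add_le _ _).trans ?_
    gcongr
    calc ‖∫ q in I ×ˢ J, (g p - g q)‖ₑ ≤ ∫⁻ q in I ×ˢ J, ‖g p - g q‖ₑ :=
          enorm_integral_le_lintegral_enorm _
      _ ≤ ∫⁻ q in I ×ˢ J, (α p.2 + β q.1) := setLIntegral_mono' hQm fun q hq => hosc p hp q hq
      _ = e * e * α p.2 + e * ∫⁻ x in I ×ˢ J, ‖g₂ x‖ₑ := by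
          rw [lintegral_add_left measurable_const, lintegral_const,
            Measure.restrict_apply_univ, hvQ, mul_comm (α p.2), ← hIβ, hprod,
            lintegral_prod (fun q => β q.1) (hmβ.comp measurable_fst).aemeasurable]
          simp only [lintegral_const, Measure.restrict_apply_univ, hvJ]
          rw [lintegral_mul_const _ hmβ, mul_comm e (∫⁻ _ in I, _)]
  have htot : e * e * ∫⁻ p in I ×ˢ J, ‖g p‖ₑ ≤ e * e * (‖∫ x in I ×ˢ J, g x‖ₑ +
      e * ((∫⁻ x in I ×ˢ J, ‖g₁ x‖ₑ) + ∫⁻ x in I ×ˢ J, ‖g₂ x‖ₑ)) := by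
    rw [← lintegral_const_mul _ hg.measurable.enorm]
    refine (setLIntegral_mono' hQm hpt).trans_eq ?_
    rw [lintegral_add_left measurable_const,
      lintegral_add_right _ measurable_const,
      lintegral_const_mul (f := fun q : ℝ × ℝ => α q.2) _ (hmα.comp measurable_snd),
      lintegral_const, lintegral_const, Measure.restrict_apply_univ, hvQ]
    have h4 : ∫⁻ p in I ×ˢ J, α p.2 = e * ∫⁻ x in I ×ˢ J, ‖g₁ x‖ₑ := by
      rw [← hIα, hprod, lintegral_prod (fun q => α q.2) (hmα.comp measurable_snd).aemeasurable]
      simp only [lintegral_const, Measure.restrict_apply_univ, hvI]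
      rw [mul_comm]
    rw [h4]
    ring
  exact (ENNReal.mul_le_mul_iff_right (mul_ne_zero he0 he0) (ENNReal.mul_ne_top het het)).1 htot

/-- The Poincaré inequality in `L¹` on a square of side `ε` in the complex plane. -/
theorem lintegral_reProdIm_le {v : ℂ → ℝ} (hv : ContDiff ℝ 1 v) (a b : ℝ) {ε : ℝ} (hε : 0 < ε) :
    ∫⁻ z in Ioc a (a + ε) ×ℂ Ioc b (b + ε), ‖v z‖ₑ ≤
      ‖∫ z in Ioc a (a + ε) ×ℂ Ioc b (b + ε), v z‖ₑ +
        ENNReal.ofReal (2 * ε) *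
          ∫⁻ z in Ioc a (a + ε) ×ℂ Ioc b (b + ε), ‖fderiv ℝ v z‖ₑ := by
  set e := Complex.measurableEquivRealProd with he
  have hmp : MeasurePreserving e.symm volume volume :=
    Complex.volume_preserving_equiv_real_prod.symm e
  have hpre : e.symm ⁻¹' (Ioc a (a + ε) ×ℂ Ioc b (b + ε)) =
      Ioc a (a + ε) ×ˢ Ioc b (b + ε) := by
    ext p
    simp [he, Complex.mem_reProdIm]
  have hes : ∀ p : ℝ × ℝ, e.symm p = p.1 + p.2 * Complex.I := fun p => by
    apply Complex.ext <;> simp [he]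
  have hec : Continuous e.symm := by
    have : (e.symm : ℝ × ℝ → ℂ) = fun p => p.1 + p.2 * Complex.I := funext hes
    rw [this]
    fun_prop
  have hfc := hv.continuous_fderiv (by simp)
  have hline : ∀ (c w : ℂ) (t : ℝ),
      HasDerivAt (fun s : ℝ => v (c + s * w)) (fderiv ℝ v (c + t * w) w) t := by
    intro c w t
    have h1 : HasDerivAt (fun s : ℝ => c + s * w) w t := by
      simpa using ((Complex.ofRealCLM.hasDerivAt (x := t)).mul_const w).const_add c
    exact ((hv.differentiable (by simp)) (c + t * w)).hasFDerivAt.comp_hasDerivAt t h1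
  have h := lintegral_square_le (g := fun p => v (e.symm p))
    (g₁ := fun p => fderiv ℝ v (e.symm p) 1) (g₂ := fun p => fderiv ℝ v (e.symm p) Complex.I)
    (hv.continuous.comp hec) ((hfc.comp hec).clm_apply continuous_const)
    ((hfc.comp hec).clm_apply continuous_const)
    (fun x y => by
      have := hline (y * Complex.I) 1 x
      simp only [hes]
      simpa only [mul_one, add_comm] using this)
    (fun x y => by
      have := hline x Complex.I y
      simp only [hes]
      simpa only using this) hε (I := Ioc a (a + ε)) (J := Ioc b (b + ε)) rfl rfl
  rw [← hpre, hmp.setLIntegral_comp_preimage_emb e.symm.measurableEmbedding (fun z => ‖v z‖ₑ),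
    hmp.setIntegral_preimage_emb e.symm.measurableEmbedding v,
    hmp.setLIntegral_comp_preimage_emb e.symm.measurableEmbedding (fun z => ‖fderiv ℝ v z 1‖ₑ),
    hmp.setLIntegral_comp_preimage_emb e.symm.measurableEmbedding
      (fun z => ‖fderiv ℝ v z Complex.I‖ₑ)] at h
  refine h.trans ?_
  have hle : ∀ w : ℂ, ‖w‖ = 1 → ∀ z, ‖fderiv ℝ v z w‖ₑ ≤ ‖fderiv ℝ v z‖ₑ := by
    intro w hw z
    rw [enorm_le_iff_norm_le]
    simpa [hw] using (fderiv ℝ v z).le_opNorm w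
  -- The factor 2 counts the two partial derivatives, each bounded by the operator norm.
  rw [mul_comm 2 ε, ENNReal.ofReal_mul hε.le, mul_assoc, ENNReal.ofReal_ofNat, two_mul]
  gcongr
  · exact hle _ (by simp) _
  · exact hle _ (by simp) _

/-- The squares of the grid of mesh `1 / N` in the complex plane. -/
def gridSquare (N : ℕ) (k : ℤ × ℤ) : Set ℂ :=
  {z | ⌈z.re * N⌉ = k.1 ∧ ⌈z.im * N⌉ = k.2}

theorem measurableSet_gridSquare (N : ℕ) (k : ℤ × ℤ) : MeasurableSet (gridSquare N k) := by
  have h1 : Measurable fun z : ℂ => ⌈z.re * N⌉ :=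
    (Complex.measurable_re.mul_const _).ceil
  have h2 : Measurable fun z : ℂ => ⌈z.im * N⌉ :=
    (Complex.measurable_im.mul_const _).ceil
  exact (h1 (measurableSet_singleton k.1)).inter (h2 (measurableSet_singleton k.2))

theorem pairwise_disjoint_gridSquare (N : ℕ) :
    Pairwise (Function.onFun Disjoint (gridSquare N)) := by
  intro k l hkl
  rw [Function.onFun, disjoint_left]
  rintro z ⟨h1, h2⟩ ⟨h3, h4⟩
  exact hkl (Prod.ext (h1.symm.trans h3) (h2.symm.trans h4))

/-- Ceilings, rather than floors, give cells open on the left and closed on the right, the shape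
`Ioc` of the Poincaré inequality; the index marks the right end, hence the `- 1`. -/
theorem gridSquare_eq {N : ℕ} (hN : 0 < N) (k : ℤ × ℤ) :
    gridSquare N k = Ioc ((k.1 - 1) / N : ℝ) ((k.1 - 1) / N + 1 / N) ×ℂ
      Ioc ((k.2 - 1) / N : ℝ) ((k.2 - 1) / N + 1 / N) := by
  have hN' : (0 : ℝ) < N := by exact_mod_cast hN
  ext z
  have : ∀ (x : ℝ) (m : ℤ), ⌈x * N⌉ = m ↔ x ∈ Ioc ((m - 1) / N : ℝ) ((m - 1) / N + 1 / N) := by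
    intro x m
    rw [Int.ceil_eq_iff, mem_Ioc, div_lt_iff₀ hN', ← add_div, sub_add_cancel, le_div_iff₀ hN']
  simp only [gridSquare, mem_ofPred_eq, this, Complex.mem_reProdIm]

theorem ball_subset_iUnion_gridSquare {N : ℕ} :
    Metric.ball (0 : ℂ) 1 ⊆
      ⋃ k ∈ Finset.Icc (-N : ℤ) N ×ˢ Finset.Icc (-N : ℤ) N, gridSquare N k := by
  intro z hz
  rw [mem_ball_zero_iff] at hz
  have : ∀ x : ℝ, |x| ≤ 1 → ⌈x * N⌉ ∈ Finset.Icc (-N : ℤ) N := by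
    intro x hx
    have hN : (0 : ℝ) ≤ N := by positivity
    rw [abs_le] at hx
    rw [Finset.mem_Icc]
    constructor
    · have h1 : (-N : ℝ) ≤ x * N := by nlinarith
      have h2 := h1.trans (Int.le_ceil (x * N))
      exact_mod_cast h2
    · rw [Int.ceil_le]
      push_cast
      nlinarith
  simp only [mem_iUnion]
  exact ⟨(⌈z.re * N⌉, ⌈z.im * N⌉), Finset.mk_mem_product
    (this _ ((Complex.abs_re_le_norm z).trans hz.le))
    (this _ ((Complex.abs_im_le_norm z).trans hz.le)), rfl, rfl⟩

/-- Since `v` vanishes off the disc, cells meeting the circle can be used as full squares, and the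
Poincaré inequality sums over the disjoint cells. -/
theorem lintegral_ball_le_sum_gridSquare {N : ℕ} (hN : 0 < N) {v : ℂ → ℝ} (hv : ContDiff ℝ 1 v)
    (hvB : tsupport v ⊆ Metric.ball 0 1) :
    eLpNorm v 1 (volume.restrict (Metric.ball 0 1)) ≤
      ∑ k ∈ Finset.Icc (-N : ℤ) N ×ˢ Finset.Icc (-N : ℤ) N,
        ‖∫ z in Metric.ball 0 1 ∩ gridSquare N k, v z‖ₑ +
      ENNReal.ofReal (2 * (1 / N)) *
        eLpNorm (fderiv ℝ v) 1 (volume.restrict (Metric.ball 0 1)) := by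
  set F := Finset.Icc (-N : ℤ) N ×ˢ Finset.Icc (-N : ℤ) N
  have hN' : (0 : ℝ) < 1 / N := by positivity
  have hdisj : (F : Set (ℤ × ℤ)).PairwiseDisjoint (gridSquare N) :=
    fun k _ l _ hkl => pairwise_disjoint_gridSquare N hkl
  have hv0 : ∀ z ∉ Metric.ball (0 : ℂ) 1, v z = 0 := fun z hz =>
    image_eq_zero_of_notMem_tsupport fun h => hz (hvB h)
  have hsq : ∀ k, ∫⁻ z in gridSquare N k, ‖v z‖ₑ ≤
      ‖∫ z in Metric.ball 0 1 ∩ gridSquare N k, v z‖ₑ +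
        ENNReal.ofReal (2 * (1 / N)) * ∫⁻ z in gridSquare N k, ‖fderiv ℝ v z‖ₑ := by
    intro k
    have h1 : ∫ z in Metric.ball 0 1 ∩ gridSquare N k, v z = ∫ z in gridSquare N k, v z := by
      rw [inter_comm]
      exact (setIntegral_eq_of_subset_of_forall_sdiff_eq_zero (measurableSet_gridSquare N k)
        inter_subset_left fun z hz => hv0 z fun h => hz.2 ⟨hz.1, h⟩).symm
    rw [h1, gridSquare_eq hN]
    exact lintegral_reProdIm_le hv _ _ hN'
  rw [eLpNorm_fderiv_restrict_eq volume hvB, eLpNorm_one_eq_lintegral_enorm,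
    eLpNorm_one_eq_lintegral_enorm]
  calc ∫⁻ z in Metric.ball 0 1, ‖v z‖ₑ
      ≤ ∫⁻ z in ⋃ k ∈ F, gridSquare N k, ‖v z‖ₑ :=
        lintegral_mono_set ball_subset_iUnion_gridSquare
    _ = ∑ k ∈ F, ∫⁻ z in gridSquare N k, ‖v z‖ₑ :=
        lintegral_biUnion_finset hdisj (fun k _ => measurableSet_gridSquare N k) _
    _ ≤ ∑ k ∈ F, (‖∫ z in Metric.ball 0 1 ∩ gridSquare N k, v z‖ₑ +
        ENNReal.ofReal (2 * (1 / N)) * ∫⁻ z in gridSquare N k, ‖fderiv ℝ v z‖ₑ) :=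
        Finset.sum_le_sum fun k _ => hsq k
    _ = ∑ k ∈ F, ‖∫ z in Metric.ball 0 1 ∩ gridSquare N k, v z‖ₑ + ENNReal.ofReal (2 * (1 / N)) *
        ∫⁻ z in ⋃ k ∈ F, gridSquare N k, ‖fderiv ℝ v z‖ₑ := by
        rw [lintegral_biUnion_finset hdisj (fun k _ => measurableSet_gridSquare N k),
          Finset.sum_add_distrib, Finset.mul_sum]
    _ ≤ _ := by
        gcongr
        exact Measure.restrict_le_self

/-- Averages over finitely many small squares control functions in `C¹_c` of the disc in `L¹`, up to
a small multiple of the Dirichlet norm. -/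
theorem exists_finset_eLpNorm_one_le {ε : ℝ} (hε : 0 < ε) :
    ∃ (F : Finset (ℤ × ℤ)) (Q : ℤ × ℤ → Set ℂ), (∀ k, MeasurableSet (Q k)) ∧
      ∀ v : ℂ → ℝ, ContDiff ℝ 1 v → tsupport v ⊆ Metric.ball 0 1 →
        eLpNorm v 1 (volume.restrict (Metric.ball 0 1)) ≤
          ∑ k ∈ F, ‖∫ z in Metric.ball 0 1 ∩ Q k, v z‖ₑ +
            ENNReal.ofReal ε * eLpNorm (fderiv ℝ v) 2 (volume.restrict (Metric.ball 0 1)) := by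
  set B := Metric.ball (0 : ℂ) 1
  have : IsFiniteMeasure ((volume : Measure ℂ).restrict B) :=
    ⟨by rw [Measure.restrict_apply_univ]; exact measure_ball_lt_top⟩
  obtain ⟨K, hK⟩ : ∃ K : ℝ≥0, ∀ f : ℂ → ℂ →L[ℝ] ℝ, Continuous f →
      eLpNorm f 1 (volume.restrict B) ≤ K * eLpNorm f 2 (volume.restrict B) := by
    refine ⟨((volume.restrict B) univ ^
      (1 / (1 : ℝ≥0∞).toReal - 1 / (2 : ℝ≥0∞).toReal)).toNNReal, fun f hf => ?_⟩
    rw [ENNReal.coe_toNNReal (ENNReal.rpow_ne_top_of_nonneg (by norm_num) (measure_ne_top _ _)),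
      mul_comm]
    exact eLpNorm_le_eLpNorm_mul_rpow_measure_univ (by norm_num) hf.aestronglyMeasurable
  -- With `K` the constant between `L¹` and `L²` on the disc, mesh `1 / N` costs `2 * K / N < ε`.
  obtain ⟨N, hN⟩ := exists_nat_gt (2 * K / ε)
  have hN0 : (0 : ℝ) < N := lt_of_le_of_lt (by positivity) hN
  refine ⟨Finset.Icc (-N : ℤ) N ×ˢ Finset.Icc (-N : ℤ) N, gridSquare N, measurableSet_gridSquare N,
    fun v hv hvB => (lintegral_ball_le_sum_gridSquare (by exact_mod_cast hN0) hv hvB).trans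
      (add_le_add le_rfl ?_)⟩
  calc ENNReal.ofReal (2 * (1 / N)) * eLpNorm (fderiv ℝ v) 1 (volume.restrict B)
      ≤ ENNReal.ofReal (2 * (1 / N)) * (K * eLpNorm (fderiv ℝ v) 2 (volume.restrict B)) := by
        gcongr
        exact hK _ (hv.continuous_fderiv (by simp))
    _ = ENNReal.ofReal (2 * (1 / N) * K) * eLpNorm (fderiv ℝ v) 2 (volume.restrict B) := by
        rw [ENNReal.ofReal_mul (p := 2 * (1 / N : ℝ)) (by positivity), mul_assoc,
          ENNReal.ofReal_coe_nnreal]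
    _ ≤ _ := by
        gcongr
        rw [div_lt_iff₀ hε] at hN
        have : 2 * (1 / N : ℝ) * K = 2 * K / N := by ring
        rw [this, div_le_iff₀ hN0]
        linarith

/-! ### A compactness criterion and interpolation. -/

/-- A bounded operator is compact if it is small on the unit ball wherever some finite-rank
operator is small. -/
theorem isCompactOperator_of_forall_exists_finiteRank {E F : Type*} [SeminormedAddCommGroup E]
    [NormedSpace ℝ E] [NormedAddCommGroup F] [NormedSpace ℝ F] [CompleteSpace F] (T : E →L[ℝ] F)
    (h : ∀ ε > 0, ∃ δ > 0, ∃ (ι : Type) (_ : Fintype ι) (A : E →L[ℝ] (ι → ℝ)),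
      ∀ u, ‖u‖ ≤ 2 → ‖A u‖ ≤ δ → ‖T u‖ ≤ ε) :
    IsCompactOperator T := by
  refine (isCompactOperator_iff_isCompact_closure_image_closedBall (𝕜₁ := ℝ) (T : E →ₗ[ℝ] F)
    zero_lt_one).2 ?_
  refine TotallyBounded.isCompact_of_isComplete ?_ isClosed_closure.isComplete
  refine TotallyBounded.closure (Metric.totallyBounded_iff.2 fun ε hε => ?_)
  obtain ⟨δ, hδ, ι, _, A, hA⟩ := h (ε / 2) (by positivity)
  -- The target of `A` is finite-dimensional, so a finite `δ`-net of the image exists; its preimages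
  -- give the `ε`-net for `T`.
  have hbdd : TotallyBounded (A '' Metric.closedBall 0 1) := by
    have hb := A.lipschitz.isBounded_image (Metric.isBounded_closedBall (x := (0 : E)) (r := 1))
    exact hb.isCompact_closure.totallyBounded.subset subset_closure
  obtain ⟨s, hsub, hsfin, hscov⟩ := exists_subset_image_finite_and.1
    (Metric.finite_approx_of_totallyBounded hbdd δ hδ)
  refine ⟨T '' s, hsfin.image T, ?_⟩
  rintro _ ⟨u, hu, rfl⟩
  obtain ⟨_, ⟨w, hw, rfl⟩, huw⟩ := mem_iUnion₂.1 (hscov (mem_image_of_mem A hu))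
  refine mem_iUnion₂.2 ⟨T w, mem_image_of_mem T hw, ?_⟩
  rw [mem_ball_iff_norm, ← map_sub] at huw
  have hu1 : ‖u‖ ≤ 1 := by simpa using hu
  have hw1 : ‖w‖ ≤ 1 := by simpa using hsub hw
  -- Differences of points of the unit ball have norm at most 2, hence that radius in the
  -- hypothesis.
  have h1 := hA (u - w) ((norm_sub_le _ _).trans (by linarith)) huw.le
  rw [map_sub] at h1
  rw [mem_ball_iff_norm]
  exact h1.trans_lt (by linarith)

/-- Interpolation of `Lʳ` between `L¹` and `L²ʳ⁻¹`. -/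
theorem eLpNorm_rpow_le_mul {α : Type*} [MeasurableSpace α] {μ : Measure α} {f : α → ℝ}
    (hf : AEStronglyMeasurable f μ) {r : ℝ} (hr : 1 ≤ r) :
    eLpNorm f (ENNReal.ofReal r) μ ^ r ≤ eLpNorm f 1 μ ^ (1 / 2 : ℝ) *
      eLpNorm f (ENNReal.ofReal (2 * r - 1)) μ ^ ((2 * r - 1) / 2) := by
  have hq : 0 < 2 * r - 1 := by linarith
  have hr0 : 0 < r := by linarith
  have key : ∀ p : ℝ, 0 < p → eLpNorm f (ENNReal.ofReal p) μ ^ p = ∫⁻ x, ‖f x‖ₑ ^ p ∂μ := by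
    intro p hp
    rw [eLpNorm_eq_lintegral_rpow_enorm_toReal (by simpa using hp) ENNReal.ofReal_ne_top,
      ENNReal.toReal_ofReal hp.le, ← ENNReal.rpow_mul, one_div_mul_cancel hp.ne',
      ENNReal.rpow_one]
  have h2 : eLpNorm f (ENNReal.ofReal (2 * r - 1)) μ ^ ((2 * r - 1) / 2) =
      (∫⁻ x, ‖f x‖ₑ ^ (2 * r - 1) ∂μ) ^ (1 / 2 : ℝ) := by
    rw [← key _ hq, ← ENNReal.rpow_mul]
    congr 1
    ring
  rw [key r hr0, h2, eLpNorm_one_eq_lintegral_enorm]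
  -- Cauchy–Schwarz for the splitting `|f|ʳ = |f|^(1/2) * |f|^(r - 1/2)`.
  have h3 := ENNReal.lintegral_mul_le_Lp_mul_Lq μ (p := 2) (q := 2) Real.HolderConjugate.two_two
    (hf.enorm.pow_const (1 / 2 : ℝ)) (hf.enorm.pow_const (r - 1 / 2))
  simp only [← ENNReal.rpow_mul, Pi.mul_apply] at h3
  convert h3 using 3 with x x
  · rw [← ENNReal.rpow_add_of_nonneg _ _ (by norm_num) (by linarith)]
    congr 1
    ring
  · simp
  · congr! 3
    ring

theorem ofReal_norm_Lp {α : Type*} [MeasurableSpace α] {μ : Measure α} {p : ℝ≥0∞}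
    (f : Lp ℝ p μ) : ENNReal.ofReal ‖f‖ = eLpNorm f p μ := by
  rw [Lp.norm_def, ENNReal.ofReal_toReal (Lp.eLpNorm_ne_top f)]

theorem norm_rpow_le_mul {α : Type*} [MeasurableSpace α] {μ : Measure α} {r : ℝ≥0∞}
    (hr1 : 1 ≤ r) (hr : r ≠ ⊤) (f : Lp ℝ r μ) (g : Lp ℝ 1 μ)
    (k : Lp ℝ (ENNReal.ofReal (2 * r.toReal - 1)) μ) (hg : f =ᵐ[μ] g) (hk : f =ᵐ[μ] k) :
    ‖f‖ ^ r.toReal ≤ ‖g‖ ^ (1 / 2 : ℝ) * ‖k‖ ^ ((2 * r.toReal - 1) / 2) := by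
  have hρ : 1 ≤ r.toReal := by simpa using ENNReal.toReal_mono hr hr1
  have h1 := eLpNorm_rpow_le_mul (Lp.aestronglyMeasurable f) hρ
  rw [ENNReal.ofReal_toReal hr, eLpNorm_congr_ae (p := 1) hg,
    eLpNorm_congr_ae (p := ENNReal.ofReal (2 * r.toReal - 1)) hk] at h1
  have h2 := ENNReal.toReal_mono (ENNReal.mul_ne_top
    (ENNReal.rpow_ne_top_of_nonneg (by norm_num) (Lp.eLpNorm_ne_top g))
    (ENNReal.rpow_ne_top_of_nonneg (by linarith) (Lp.eLpNorm_ne_top k))) h1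
  rwa [ENNReal.toReal_mul, ← ENNReal.toReal_rpow, ← ENNReal.toReal_rpow, ← ENNReal.toReal_rpow,
    ← Lp.norm_def, ← Lp.norm_def, ← Lp.norm_def] at h2

/-! ### The bounded embedding. -/

/-- `u` is tied to `η` only through its underlying function; uniqueness of weak gradients
(`W12_ext`) identifies `sobolevGrad u` with the classical gradient. -/
theorem IsTestFunction.eLpNorm_fderiv_le {Ω : Set ℂ} (hΩ : IsOpen Ω) {η : ℂ → ℝ}
    (hη : IsTestFunction Ω η) {u : W12 Ω} (hu : sobolevFun u =ᵐ[volume.restrict Ω] η) :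
    eLpNorm (fderiv ℝ η) 2 (volume.restrict Ω) ≤ ENNReal.ofReal ‖u‖ := by
  obtain ⟨w, -, hw, hwg⟩ := exists_mem_testFunctions hη
  obtain rfl : u = w := W12_ext hΩ (Lp.ext (hu.trans hw.symm))
  have h1 : eLpNorm (fderiv ℝ η) 2 (volume.restrict Ω) =
      eLpNorm (sobolevGrad u) 2 (volume.restrict Ω) := by
    refine eLpNorm_congr_norm_ae ?_
    filter_upwards [hwg] with z hz
    rw [hz, gradient, LinearIsometryEquiv.norm_map]
  rw [h1, ← ENNReal.ofReal_toReal (Lp.eLpNorm_ne_top (sobolevGrad u)), ← Lp.norm_def, W12_norm_eq]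
  exact ENNReal.ofReal_le_ofReal (le_add_of_nonneg_left (norm_nonneg _))

theorem norm_sobolevFun_sub_le {Ω : Set ℂ} (u w : W12 Ω) :
    ‖sobolevFun u - sobolevFun w‖ ≤ ‖u - w‖ := by
  rw [W12_norm_eq (u - w)]
  exact le_add_of_nonneg_right (norm_nonneg _)

/-- Every element of `W̊¹₂(Ω)` is the limit, in norm and almost everywhere, of test functions. -/
theorem exists_seq_testFunctions_tendsto {Ω : Set ℂ} {u : W12 Ω} (hu : u ∈ W12Zero Ω) :
    ∃ s : ℕ → W12 Ω, (∀ n, s n ∈ testFunctions Ω) ∧ Filter.Tendsto s Filter.atTop (𝓝 u) ∧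
      ∀ᵐ z ∂(volume.restrict Ω),
        Filter.Tendsto (fun n => sobolevFun (s n) z) Filter.atTop (𝓝 (sobolevFun u z)) := by
  obtain ⟨s, hs, hsu⟩ := mem_closure_iff_seq_limit.1 hu
  have h1 : Filter.Tendsto (fun n => sobolevFun (s n)) Filter.atTop (𝓝 (sobolevFun u)) := by
    rw [tendsto_iff_norm_sub_tendsto_zero] at hsu ⊢
    exact squeeze_zero (fun _ => norm_nonneg _) (fun n => norm_sobolevFun_sub_le _ _) hsu
  obtain ⟨ns, hns, hae⟩ := (tendstoInMeasure_of_tendsto_Lp h1).exists_seq_tendsto_ae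
  exact ⟨s ∘ ns, fun n => hs _, hsu.comp hns.tendsto_atTop, hae⟩

/-- On test functions this is the Sobolev inequality on the disc, pulled back by conformal
invariance. Fatou's lemma along an almost everywhere convergent sequence extends it to the closure
without assuming that the limit lies in `Lʳ`. -/
theorem IsConformalOntoDisc.exists_eLpNorm_le {Ω : Set ℂ} (hΩ : IsOpen Ω) {φ : ℂ → ℂ}
    (hφ : IsConformalOntoDisc Ω φ) {r : ℝ≥0∞} (hr1 : 1 ≤ r) (hr : r ≠ ⊤) :
    ∃ C : ℝ≥0, ∀ u ∈ W12Zero Ω,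
      eLpNorm (sobolevFun u) r (conformalMeasure Ω φ) ≤ C * ENNReal.ofReal ‖u‖ := by
  lift r to ℝ≥0 using hr
  obtain ⟨C, hC⟩ := exists_eLpNorm_le_eLpNorm_fderiv_two
    (Metric.isBounded_ball (x := (0 : ℂ)) (r := 1)) r (by exact_mod_cast hr1)
  have htest : ∀ u ∈ testFunctions Ω,
      eLpNorm (sobolevFun u) r (conformalMeasure Ω φ) ≤ C * ENNReal.ofReal ‖u‖ := by
    rintro u ⟨η, hη, hu⟩
    obtain ⟨v, hv, hvB, hvφ⟩ := hη.exists_transplant hΩ hφ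
    rw [eLpNorm_congr_ae ((conformalMeasure_absolutelyContinuous Ω φ).ae_eq hu),
      hφ.eLpNorm_eq hΩ hvφ (zero_lt_one.trans_le hr1).ne' ENNReal.coe_ne_top]
    refine (hC v hv hvB).trans ?_
    rw [← hφ.eLpNorm_fderiv_eq hΩ hvφ (hv.differentiable (by simp))]
    gcongr
    exact hη.eLpNorm_fderiv_le hΩ hu
  refine ⟨C, fun u hu => ?_⟩
  obtain ⟨s, hs, hsu, hae⟩ := exists_seq_testFunctions_tendsto hu
  have h1 := Lp.eLpNorm_lim_le_liminf_eLpNorm (p := (r : ℝ≥0∞)) (μ := conformalMeasure Ω φ)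
    (fun n => (Lp.aestronglyMeasurable (sobolevFun (s n))).mono_ac
      (conformalMeasure_absolutelyContinuous Ω φ)) (sobolevFun u)
    ((conformalMeasure_absolutelyContinuous Ω φ).ae_le hae)
  have h2 : Filter.Tendsto (fun n => (C : ℝ≥0∞) * ENNReal.ofReal ‖s n‖) Filter.atTop
      (𝓝 (C * ENNReal.ofReal ‖u‖)) :=
    ENNReal.Tendsto.const_mul (ENNReal.tendsto_ofReal hsu.norm) (Or.inr ENNReal.coe_ne_top)
  rw [← h2.liminf_eq]
  exact h1.trans (Filter.liminf_le_liminf (Filter.Eventually.of_forall fun n => htest _ (hs n)))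

/-- The bounded embedding of `W̊¹₂(Ω)` into the weighted Lebesgue space. -/
theorem IsConformalOntoDisc.exists_embedding {Ω : Set ℂ} (hΩ : IsOpen Ω) {φ : ℂ → ℂ}
    (hφ : IsConformalOntoDisc Ω φ) (r : ℝ≥0∞) [Fact (1 ≤ r)] (hr : r ≠ ⊤) :
    ∃ j : W12Zero Ω →L[ℝ] Lp ℝ r (conformalMeasure Ω φ),
      ∀ u : W12Zero Ω, (j u : ℂ → ℝ) =ᵐ[conformalMeasure Ω φ] sobolevFun (u : W12 Ω) := by
  obtain ⟨C, hC⟩ := hφ.exists_eLpNorm_le hΩ (Fact.out : 1 ≤ r) hr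
  have hac := conformalMeasure_absolutelyContinuous Ω φ
  have hmem : ∀ u : W12Zero Ω, MemLp (sobolevFun (u : W12 Ω)) r (conformalMeasure Ω φ) :=
    fun u => ⟨(Lp.aestronglyMeasurable _).mono_ac hac,
      (hC u u.2).trans_lt (ENNReal.mul_lt_top ENNReal.coe_lt_top ENNReal.ofReal_lt_top)⟩
  let j₀ : W12Zero Ω →ₗ[ℝ] Lp ℝ r (conformalMeasure Ω φ) :=
    { toFun := fun u => (hmem u).toLp _
      map_add' := fun u w => by
        rw [← MemLp.toLp_add]
        exact MemLp.toLp_congr _ _ (hac.ae_eq (Lp.coeFn_add (sobolevFun (u : W12 Ω))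
          (sobolevFun (w : W12 Ω))))
      map_smul' := fun c u => by
        rw [RingHom.id_apply, ← MemLp.toLp_const_smul]
        exact MemLp.toLp_congr _ _ (hac.ae_eq (Lp.coeFn_smul c (sobolevFun (u : W12 Ω)))) }
  refine ⟨j₀.mkContinuous C fun u => ?_, fun u => (hmem u).coeFn_toLp⟩
  change ‖(hmem u).toLp _‖ ≤ _
  rw [Lp.norm_toLp]
  refine ENNReal.toReal_le_of_le_ofReal (by positivity) ((hC u u.2).trans_eq ?_)
  rw [ENNReal.ofReal_mul C.coe_nonneg, ENNReal.ofReal_coe_nnreal]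
  rfl

/-! ### Compactness of the embedding. -/

/-- Integration over a set as a bounded functional on `L¹`. -/
def setIntegralL1 {α : Type*} [MeasurableSpace α] (μ : Measure α) (s : Set α) :
    Lp ℝ 1 μ →L[ℝ] ℝ where
  toFun f := ∫ x in s, f x ∂μ
  map_add' f g := by
    rw [← integral_add (L1.integrable_coeFn f).integrableOn (L1.integrable_coeFn g).integrableOn]
    exact integral_congr_ae (ae_restrict_of_ae (Lp.coeFn_add f g))
  map_smul' c f := by
    rw [RingHom.id_apply, ← integral_smul]
    exact integral_congr_ae (ae_restrict_of_ae (Lp.coeFn_smul c f))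
  cont := continuous_setIntegral s

/-- Finitely many averages control the weighted `L¹` norm on `W̊¹₂(Ω)`, up to a small multiple of
the Sobolev norm. -/
theorem IsConformalOntoDisc.exists_finiteRank_norm_le {Ω : Set ℂ} (hΩ : IsOpen Ω) {φ : ℂ → ℂ}
    (hφ : IsConformalOntoDisc Ω φ) (j : W12Zero Ω →L[ℝ] Lp ℝ 1 (conformalMeasure Ω φ))
    (hj : ∀ u : W12Zero Ω, (j u : ℂ → ℝ) =ᵐ[conformalMeasure Ω φ] sobolevFun (u : W12 Ω))
    {ε : ℝ} (hε : 0 < ε) :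
    ∃ (ι : Type) (_ : Fintype ι) (A : W12Zero Ω →L[ℝ] (ι → ℝ)),
      ∀ u, ‖j u‖ ≤ ∑ i, ‖A u i‖ + ε * ‖u‖ := by
  obtain ⟨F, Q, hQ, hF⟩ := exists_finset_eLpNorm_one_le hε
  let A : W12Zero Ω →L[ℝ] (F → ℝ) := ContinuousLinearMap.pi fun k =>
    (setIntegralL1 (conformalMeasure Ω φ) (Ω ∩ φ ⁻¹' Q k)).comp j
  refine ⟨F, inferInstance, A, fun u => ?_⟩
  -- Both sides are continuous in `u`, so the estimate need only be checked on the dense set of test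
  -- functions, where transplantation is available.
  have hclosed : IsClosed {u | ‖j u‖ ≤ ∑ i, ‖A u i‖ + ε * ‖u‖} := by
    have : Continuous fun u => ∑ i, ‖A u i‖ + ε * ‖u‖ := by fun_prop
    exact isClosed_le j.continuous.norm this
  have hdense : Dense {u : W12Zero Ω | (u : W12 Ω) ∈ testFunctions Ω} := by
    rw [Subtype.dense_iff]
    intro w hw
    refine closure_mono ?_ (show w ∈ closure (testFunctions Ω : Set (W12 Ω)) from hw)
    intro x hx
    exact ⟨⟨x, (testFunctions Ω).le_topologicalClosure hx⟩, hx, rfl⟩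
  refine hclosed.closure_subset_iff.2 ?_ (hdense u)
  rintro u ⟨η, hη, hu⟩
  have hjη : (j u : ℂ → ℝ) =ᵐ[conformalMeasure Ω φ] η :=
    (hj u).trans ((conformalMeasure_absolutelyContinuous Ω φ).ae_eq hu)
  obtain ⟨v, hv, hvB, hvφ⟩ := hη.exists_transplant hΩ hφ
  have h1 := hF v hv hvB
  rw [← hφ.eLpNorm_eq hΩ hvφ one_ne_zero ENNReal.one_ne_top, ← eLpNorm_congr_ae hjη,
    ← hφ.eLpNorm_fderiv_eq hΩ hvφ (hv.differentiable (by simp)), ← Finset.sum_coe_sort F] at h1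
  have h2 : ∀ k : F, ∫ z in Metric.ball 0 1 ∩ Q k, v z = A u k := fun k => by
    rw [← hφ.setIntegral_conformalMeasure hΩ hvφ (hQ k)]
    exact (integral_congr_ae (ae_restrict_of_ae hjη)).symm
  simp only [h2] at h1
  have h3 : ENNReal.ofReal ‖j u‖ ≤ ENNReal.ofReal (∑ i, ‖A u i‖ + ε * ‖u‖) := by
    rw [ofReal_norm_Lp (j u), ENNReal.ofReal_add (by positivity) (by positivity),
      ENNReal.ofReal_sum_of_nonneg fun _ _ => norm_nonneg _, ENNReal.ofReal_mul hε.le]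
    simp only [ofReal_norm (A u _)]
    refine h1.trans (add_le_add le_rfl ?_)
    gcongr
    exact hη.eLpNorm_fderiv_le hΩ hu
  exact (ENNReal.ofReal_le_ofReal_iff (by positivity)).1 h3

/-- Compactness in `L¹` and boundedness in `L²ʳ⁻¹` give compactness in `Lʳ`. -/
theorem isCompactOperator_Lp_of_finiteRank_norm_le {E α : Type*} [SeminormedAddCommGroup E]
    [NormedSpace ℝ E] [MeasurableSpace α] {μ : Measure α} {r : ℝ≥0∞} [Fact (1 ≤ r)] (hr : r ≠ ⊤)
    [Fact (1 ≤ ENNReal.ofReal (2 * r.toReal - 1))] (j : E →L[ℝ] Lp ℝ r μ) (j₁ : E →L[ℝ] Lp ℝ 1 μ)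
    (jq : E →L[ℝ] Lp ℝ (ENNReal.ofReal (2 * r.toReal - 1)) μ) (h1j : ∀ u, j u =ᵐ[μ] j₁ u)
    (hqj : ∀ u, j u =ᵐ[μ] jq u)
    (hA : ∀ ε : ℝ, 0 < ε → ∃ (ι : Type) (_ : Fintype ι) (A : E →L[ℝ] (ι → ℝ)),
      ∀ u, ‖j₁ u‖ ≤ ∑ i, ‖A u i‖ + ε * ‖u‖) :
    IsCompactOperator j := by
  have hr1 : 1 ≤ r := Fact.out
  have hρ1 : 1 ≤ r.toReal := by simpa using ENNReal.toReal_mono hr hr1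
  refine isCompactOperator_of_forall_exists_finiteRank j fun ε hε => ?_
  set ρ := r.toReal
  set q := 2 * ρ - 1 with hq
  have hq1 : 1 ≤ q := by linarith
  set M := (‖jq‖ * 2) ^ (q / 2) with hM
  have hM0 : 0 ≤ M := by positivity
  -- Chosen so that `κ ^ (1/2) * M ≤ ε ^ ρ`; the `+ 1` covers `M = 0`.
  set κ := (ε ^ ρ / (M + 1)) ^ 2 with hκ
  have hκ0 : 0 < κ := by positivity
  obtain ⟨ι, _, A, hA⟩ := hA (κ / 4) (by positivity)
  -- The averages contribute at most `κ / 2`, and the error `κ / 4 * ‖u‖` with `‖u‖ ≤ 2` the other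
  -- half; the `+ 1` allows an empty `ι`.
  refine ⟨κ / 2 / (Fintype.card ι + 1), by positivity, ι, inferInstance, A, fun u hu hAu => ?_⟩
  have h1 : ‖j₁ u‖ ≤ κ := by
    have h2 : ∑ i, ‖A u i‖ ≤ κ / 2 := by
      calc ∑ i, ‖A u i‖ ≤ ∑ _i : ι, κ / 2 / (Fintype.card ι + 1) :=
            Finset.sum_le_sum fun i _ => (norm_le_pi_norm (A u) i).trans hAu
        _ = κ / 2 * (Fintype.card ι / (Fintype.card ι + 1)) := by
            rw [Finset.sum_const, Finset.card_univ, nsmul_eq_mul]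
            ring
        _ ≤ κ / 2 * 1 := by
            gcongr
            rw [div_le_one (by positivity)]
            linarith
        _ = κ / 2 := mul_one _
    have h3 : κ / 4 * ‖u‖ ≤ κ / 4 * 2 := by gcongr
    linarith [hA u]
  have h4 : ‖jq u‖ ^ (q / 2) ≤ M := by
    refine Real.rpow_le_rpow (norm_nonneg _) ((jq.le_opNorm u).trans ?_) (by linarith)
    gcongr
  have h5 : ‖j₁ u‖ ^ (1 / 2 : ℝ) ≤ ε ^ ρ / (M + 1) := by
    refine (Real.rpow_le_rpow (norm_nonneg _) h1 (by norm_num)).trans_eq ?_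
    rw [hκ, ← Real.sqrt_eq_rpow, Real.sqrt_sq (by positivity)]
  have h6 : ‖j u‖ ^ ρ ≤ ε ^ ρ := by
    refine (norm_rpow_le_mul hr1 hr (j u) (j₁ u) (jq u) (h1j u) (hqj u)).trans
      ((mul_le_mul h5 h4 (by positivity) (by positivity)).trans ?_)
    rw [div_mul_eq_mul_div, div_le_iff₀ (by positivity)]
    have : 0 < ε ^ ρ := by positivity
    nlinarith
  exact (Real.rpow_le_rpow_iff (norm_nonneg _) hε.le (by linarith)).1 h6
-- Both 1 and `2r - 1` lie in `[1, ∞)`, so bounded embeddings exist at these two exponents and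
-- interpolation applies.
theorem IsConformalOntoDisc.isCompactOperator_embedding {Ω : Set ℂ} (hΩ : IsOpen Ω) {φ : ℂ → ℂ}
    (hφ : IsConformalOntoDisc Ω φ) (r : ℝ≥0∞) [Fact (1 ≤ r)] (hr : r ≠ ⊤)
    (j : W12Zero Ω →L[ℝ] Lp ℝ r (conformalMeasure Ω φ))
    (hj : ∀ u : W12Zero Ω, (j u : ℂ → ℝ) =ᵐ[conformalMeasure Ω φ] sobolevFun (u : W12 Ω)) :
    IsCompactOperator j := by
  have hρ : 1 ≤ r.toReal := by simpa using ENNReal.toReal_mono hr (Fact.out : 1 ≤ r)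
  have : Fact (1 ≤ ENNReal.ofReal (2 * r.toReal - 1)) :=
    ⟨by rw [ENNReal.one_le_ofReal]; linarith⟩
  obtain ⟨j₁, hj₁⟩ := hφ.exists_embedding hΩ 1 ENNReal.one_ne_top
  obtain ⟨jq, hjq⟩ := hφ.exists_embedding hΩ (ENNReal.ofReal (2 * r.toReal - 1))
    ENNReal.ofReal_ne_top
  exact @isCompactOperator_Lp_of_finiteRank_norm_le (W12Zero Ω) ℂ _ (W12Zero Ω).normedSpace _ _ r
    _ hr _ j j₁ jq (fun u => (hj u).trans (hj₁ u).symm) (fun u => (hj u).trans (hjq u).symm)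
    fun ε hε => hφ.exists_finiteRank_norm_le hΩ j₁ hj₁ hε

end

theorem theorem4p2 (Ω : Set ℂ) (hΩ : IsOpen Ω) (hsc : IsSimplyConnected Ω)
    (hfr : (frontier Ω).Nonempty) (φ : ℂ → ℂ) (hφ : IsConformalOntoDisc Ω φ)
    (r : ℝ≥0∞) [Fact (1 ≤ r)] (hr : r ≠ ⊤) :
    ∃ j : W12Zero Ω →L[ℝ] Lp ℝ r (conformalMeasure Ω φ),
      (∀ u : W12Zero Ω, (j u : ℂ → ℝ) =ᵐ[volume.restrict Ω] sobolevFun (u : W12 Ω)) ∧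
        IsCompactOperator j := by
  obtain ⟨j, hj⟩ := hφ.exists_embedding hΩ r hr
  -- As the derivative of `φ` has no zeros on `Ω`, equality almost everywhere for the weight gives
  -- it for Lebesgue measure.
  exact ⟨j, fun u => (hφ.absolutelyContinuous_conformalMeasure hΩ).ae_eq (hj u),
    hφ.isCompactOperator_embedding hΩ r hr j hj⟩
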